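/- Let $n\ge 1$ and let $X_1,\dots,X_n$ be independent real random variables with common distribution $F$, and let $\theta_0$ be a median of $F$, i.e. $\mathbb P(X_i\le\theta_0)\ge 1/2$ and $\mathbb P(X_i\ge\theta_0)\ge 1/2$ (nothing else is assumed on $F$). For $\alpha\in(0,1)$ let $c_{n,\alpha}$ be the smallest integer $x$ with $\mathbb P(Y_n\ge\lfloor n/2\rfloor-x)\ge 1-\alpha/2$, where $Y_n\sim\mathrm{Bin}(n,1/2)$, and let $\widehat{\mathrm{CI}}_{n,\alpha}$ be the set of all $\theta\in\mathbb R$ such that both $$\sum_{i=1}^n\mathbf 1\{X_i\le\theta\}\ \ge\ \lfloor n/2\rfloor-c_{n,\alpha}\qquad\text{and}\qquad \sum_{i=1}^n\mathbf 1\{X_i\ge\theta\}\ \ge\ \lfloor n/2\rfloor-c_{n,\alpha}.$$ Let $X_{(1)}\le\dots\le X_{(n)}$ be the order statistics and let $z_{\alpha/2}$ be the $(1-\alpha/2)$-quantile of the standard normal distribution. Then, for every $\alpha\in(0,1)$: 1. $\mathbb P(\theta_0\in\widehat{\mathrm{CI}}_{n,\alpha})\ge 1-\alpha$. 2. If $n\ge\log_2(2/\alpha)$,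 then the indices $\lfloor n/2\rfloor-c_{n,\alpha}$ and $\lceil n/2\rceil+c_{n,\alpha}+1$ lie in $\{1,\dots,n\}$ and $\widehat{\mathrm{CI}}_{n,\alpha}=\bigl[X_{(\lfloor n/2\rfloor-c_{n,\alpha})},\,X_{(\lceil n/2\rceil+c_{n,\alpha}+1)}\bigr]$; if $n<\log_2(2/\alpha)$, then $\widehat{\mathrm{CI}}_{n,\alpha}=\mathbb R$. 3. If $n\ge\log_2(2/\alpha)$, then $$-\frac{1}{2\sqrt n}\max\Bigl\{\frac{z_{\alpha/2}^3}{5},\ \sqrt{1+\frac{2\ln 2-1}{n^2}}\Bigr\}-1.5\ \le\ c_{n,\alpha}-\frac{\sqrt n\,z_{\alpha/2}}{2}\ \le\ 1;$$ if $n<\log_2(2/\alpha)$, then $c_{n,\alpha}-\frac{\sqrt n\,z_{\alpha/2}}{2}=\lfloor n/2\rfloor-\frac{\sqrt n\,z_{\alpha/2}}{2}$. -/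

import Mathlib

open MeasureTheory ProbabilityTheory

noncomputable section

namespace MedianCI

/-- The point `1/2` of the unit interval. -/
def half : unitInterval := ⟨1 / 2, by norm_num, by norm_num⟩

/-- `P(Y ≥ m)` for `Y ∼ Bin(n, 1/2)` and an integer `m`. -/
def binTail (n : ℕ) (m : ℤ) : ℝ :=
  (binomial n half).real {y : ℕ | m ≤ (y : ℤ)}

/-- The constant `c_{n,α}`: the smallest integer `x` such that
`P(Y ≥ ⌊n/2⌋ - x) ≥ 1 - α/2`, where `Y ∼ Bin(n, 1/2)`. -/
def binConst (n : ℕ) (α : ℝ) : ℤ :=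
  sInf {x : ℤ | 1 - α / 2 ≤ binTail n (⌊(n : ℝ) / 2⌋ - x)}

/-- The infimum defining `binConst` is attained. -/
theorem isLeast_binConst (n : ℕ) {α : ℝ} (h0 : 0 < α) (h1 : α < 1) :
    IsLeast {x : ℤ | 1 - α / 2 ≤ binTail n (⌊(n : ℝ) / 2⌋ - x)} (binConst n α) := by
  have hne : {x : ℤ | 1 - α / 2 ≤ binTail n (⌊(n : ℝ) / 2⌋ - x)}.Nonempty := by
    refine ⟨⌊(n : ℝ) / 2⌋, ?_⟩
    have : {y : ℕ | (0 : ℤ) ≤ (y : ℤ)} = Set.univ := by ext y; simp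
    simp only [Set.mem_setOf_eq, sub_self, binTail, this, probReal_univ]
    linarith
  have hbd : BddBelow {x : ℤ | 1 - α / 2 ≤ binTail n (⌊(n : ℝ) / 2⌋ - x)} := by
    refine ⟨⌊(n : ℝ) / 2⌋ - n, fun x hx => ?_⟩
    by_contra! hlt
    have hzero : binTail n (⌊(n : ℝ) / 2⌋ - x) = 0 := by
      unfold binTail
      rw [measureReal_eq_zero_iff]
      have hae : ∀ᵐ y ∂(binomial n half), y ≤ n :=
        ae_le_of_hasLaw_binomial (X := id) HasLaw.id
      refine measure_mono_null (fun y hy => ?_) hae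
      simp only [Set.mem_setOf_eq] at hy
      simp only [Set.mem_compl_iff, Set.mem_setOf_eq]
      omega
    simp only [Set.mem_setOf_eq, hzero] at hx
    linarith
  exact ⟨Int.csInf_mem hne hbd, fun x hx => csInf_le hbd hx⟩

/-- The upper `β`-quantile `z_β` of the standard normal distribution, that is, the
`(1 - β)`-quantile `inf {z : Φ(z) ≥ 1 - β}`. -/
def normalUpperQuantile (β : ℝ) : ℝ :=
  sInf {z : ℝ | 1 - β ≤ cdf (gaussianReal 0 1) z}

/-- The set of `θ` such that at least `⌊n/2⌋ - c_{n,α}` of the data are `≤ θ`. -/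
def lowerSet (n : ℕ) (α : ℝ) (x : Fin n → ℝ) : Set ℝ :=
  {θ : ℝ | ⌊(n : ℝ) / 2⌋ - binConst n α ≤ ((Finset.univ.filter fun i => x i ≤ θ).card : ℤ)}

/-- The set of `θ` such that at least `⌊n/2⌋ - c_{n,α}` of the data are `≥ θ`. -/
def upperSet (n : ℕ) (α : ℝ) (x : Fin n → ℝ) : Set ℝ :=
  {θ : ℝ | ⌊(n : ℝ) / 2⌋ - binConst n α ≤ ((Finset.univ.filter fun i => θ ≤ x i).card : ℤ)}

/-- The confidence interval for the median computed from the data `x`. -/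
def confInt (n : ℕ) (α : ℝ) (x : Fin n → ℝ) : Set ℝ :=
  lowerSet n α x ∩ upperSet n α x

/-- The `k`-th order statistic `x_(k)` for `1 ≤ k ≤ n`: the `k`-th entry of the data sorted in
nondecreasing order (and `0` for `k` out of range). -/
def orderStat {n : ℕ} (x : Fin n → ℝ) (k : ℤ) : ℝ :=
  if h : 1 ≤ k ∧ k ≤ (n : ℤ) then x (Tuple.sort x ⟨(k - 1).toNat, by omega⟩) else 0

end MedianCI

end

/-!
Coverage and the shape of the interval are elementary. Under a median `θ₀` each count
`#{i | X i ≤ θ₀}`, `#{i | θ₀ ≤ X i}` is binomial with success probability at least `1 / 2`, and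
binomial tails increase with that probability (`measureReal_card_lt_le`), so each of the two defining
inequalities fails with probability at most `α / 2`. The counts are related to order statistics by
sorting the data. The threshold `log₂ (2 / α) ≤ n` says exactly that `P(Y ≥ 1) = 1 - 2 ^ (-n)` reaches
`1 - α / 2`, that is, `⌊n / 2⌋ - c ≥ 1`; below the threshold `c = ⌊n / 2⌋` and nothing is excluded.

The bounds on `c` rest on the Zubkov–Serov inequality `cdf_signedRoot_le_one_sub_binLower`: for
`0 < k < n` and `x = k / n`, the tail `P(Bin(n, p) ≥ k)` is at least
`Φ(sgn(p - x) √(2 n KL(x, p)))`. As functions of `p` the two sides agree at both ends of `(0, 1)`, and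
the ratio of their derivatives is monotone (`entRatio_antitone`), so their difference first increases
and then decreases, hence is nonnegative; no estimate of factorials is involved.

At `p = 1 / 2` put `x = (1 + u) / 2`, so that `2 KL = H(u) = (1 + u) log (1 + u) + (1 - u) log (1 - u)`.
For the upper bound on `c` Pinsker's inequality `H(u) ≥ u ^ 2` suffices. For the lower bound,
`H(u) ≤ (u + u ^ 3 / 5) ^ 2` (`entropy_le`) gives `z ≤ √n (u + u ^ 3 / 5)` with
`n u = 2 ⌈n / 2⌉ + 2 c + 2 - n ≤ 2 c + 3`, and then `z - z ^ 3 / (5 n) ≤ √n u` (`sub_cube_le`).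
-/

namespace MedianCI

/-! ### Relative entropy of Bernoulli laws -/

/-- Kullback–Leibler divergence of the Bernoulli law with parameter `x` from the one with
parameter `p`; meaningful for `x` and `p` in `(0, 1)`. -/
noncomputable def relEnt (x p : ℝ) : ℝ :=
  x * Real.log (x / p) + (1 - x) * Real.log ((1 - x) / (1 - p))

theorem relEnt_self {x : ℝ} (hx0 : 0 < x) (hx1 : x < 1) : relEnt x x = 0 := by
  have h : 1 - x ≠ 0 := by linarith
  simp [relEnt, hx0.ne', h]

theorem hasDerivAt_relEnt {x p : ℝ} (hx0 : 0 < x) (hx1 : x < 1) (hp0 : 0 < p) (hp1 : p < 1) :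
    HasDerivAt (relEnt x) ((p - x) / (p * (1 - p))) p := by
  have h1 : 1 - x ≠ 0 := by linarith
  have h2 : 1 - p ≠ 0 := by linarith
  have hd : HasDerivAt (fun q : ℝ => 1 - q) (-1) p := by
    simpa using (hasDerivAt_id p).const_sub 1
  have ha := (((hasDerivAt_const p x).div (hasDerivAt_id p) hp0.ne').log
    (div_ne_zero hx0.ne' hp0.ne')).const_mul x
  have hb := (((hasDerivAt_const p (1 - x)).div hd h2).log (div_ne_zero h1 h2)).const_mul (1 - x)
  refine (ha.add hb).congr_deriv ?_
  simp only [id, Pi.div_apply]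
  field_simp
  ring

/-- A function on `(0, 1)` whose derivative is nonnegative and that vanishes at `x` is nonpositive
to the left of `x` and nonnegative to the right. -/
theorem sign_of_deriv_nonneg {f f' : ℝ → ℝ} {x : ℝ} (hx0 : 0 < x) (hx1 : x < 1) (hfx : f x = 0)
    (hf : ∀ p, 0 < p → p < 1 → HasDerivAt f (f' p) p) (hf' : ∀ p, 0 < p → p < 1 → 0 ≤ f' p)
    {p : ℝ} (hp0 : 0 < p) (hp1 : p < 1) : (p ≤ x → f p ≤ 0) ∧ (x ≤ p → 0 ≤ f p) := by
  have hm : MonotoneOn f (Set.Ioo 0 1) := by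
    refine monotoneOn_of_deriv_nonneg (convex_Ioo 0 1)
      (fun q hq => (hf q hq.1 hq.2).continuousAt.continuousWithinAt) ?_ ?_
    · rw [interior_Ioo]
      exact fun q hq => (hf q hq.1 hq.2).differentiableAt.differentiableWithinAt
    · rw [interior_Ioo]
      intro q hq
      rw [(hf q hq.1 hq.2).deriv]
      exact hf' q hq.1 hq.2
  refine ⟨fun h => ?_, fun h => ?_⟩
  · rw [← hfx]
    exact hm ⟨hp0, hp1⟩ ⟨hx0, hx1⟩ h
  · rw [← hfx]
    exact hm ⟨hx0, hx1⟩ ⟨hp0, hp1⟩ h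

/-- The sign of this difference is, up to positive factors, minus the sign of the derivative of
`entRatio x` times `p - x`. -/
theorem relEnt_compare_left {x p : ℝ} (hx0 : 0 < x) (hx1 : x < 1) (hp0 : 0 < p) (hp1 : p < 1) :
    (p ≤ x → relEnt x p - (p - x) ^ 2 / (2 * p * (1 - x)) ≤ 0) ∧
      (x ≤ p → 0 ≤ relEnt x p - (p - x) ^ 2 / (2 * p * (1 - x))) := by
  have h1 : 0 < 1 - x := by linarith
  refine sign_of_deriv_nonneg (f := fun p => relEnt x p - (p - x) ^ 2 / (2 * p * (1 - x)))
    (f' := fun p => (p - x) ^ 2 * (1 + p) / (2 * p ^ 2 * (1 - p) * (1 - x))) hx0 hx1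
    (by simp [relEnt_self hx0 hx1]) ?_ ?_ hp0 hp1
  · intro q hq0 hq1
    have h2 : 0 < 1 - q := by linarith
    have hn : HasDerivAt (fun q : ℝ => (q - x) ^ 2) (2 * (q - x)) q := by
      simpa using ((hasDerivAt_id q).sub_const x).fun_pow 2
    have hd : HasDerivAt (fun q : ℝ => 2 * q * (1 - x)) (2 * (1 - x)) q := by
      simpa using ((hasDerivAt_id q).const_mul 2).mul_const (1 - x)
    refine ((hasDerivAt_relEnt hx0 hx1 hq0 hq1).sub (hn.div hd (by positivity))).congr_deriv ?_
    field_simp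
    ring
  · intro q hq0 hq1
    have h2 : 0 < 1 - q := by linarith
    positivity

/-- Rearranged, `entRatio x` is at least `(1 - x) / (2 * x)`, its limit at `x`, to the left of `x`
and at most that to the right. -/
theorem relEnt_compare_right {x p : ℝ} (hx0 : 0 < x) (hx1 : x < 1) (hp0 : 0 < p) (hp1 : p < 1) :
    (p ≤ x → (1 - x) * (p - x) ^ 2 / (2 * x * (1 - p) ^ 2) - relEnt x p ≤ 0) ∧
      (x ≤ p → 0 ≤ (1 - x) * (p - x) ^ 2 / (2 * x * (1 - p) ^ 2) - relEnt x p) := by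
  have h1 : 0 < 1 - x := by linarith
  refine sign_of_deriv_nonneg
    (f := fun p => (1 - x) * (p - x) ^ 2 / (2 * x * (1 - p) ^ 2) - relEnt x p)
    (f' := fun p => (p - x) ^ 2 * (1 - x * p) / (x * p * (1 - p) ^ 3)) hx0 hx1
    (by simp [relEnt_self hx0 hx1]) ?_ ?_ hp0 hp1
  · intro q hq0 hq1
    have h2 : 0 < 1 - q := by linarith
    have hn : HasDerivAt (fun q : ℝ => (1 - x) * (q - x) ^ 2) ((1 - x) * (2 * (q - x))) q := by
      simpa using (((hasDerivAt_id q).sub_const x).fun_pow 2).const_mul (1 - x)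
    have hd : HasDerivAt (fun q : ℝ => 2 * x * (1 - q) ^ 2) (2 * x * (-(2 * (1 - q)))) q := by
      simpa using (((hasDerivAt_id q).const_sub 1).fun_pow 2).const_mul (2 * x)
    refine ((hn.div hd (by positivity)).sub (hasDerivAt_relEnt hx0 hx1 hq0 hq1)).congr_deriv ?_
    field_simp
    ring
  · intro q hq0 hq1
    have h2 : 0 < 1 - q := by linarith
    have h3 : 0 < 1 - x * q := by nlinarith
    positivity

theorem relEnt_pos {x p : ℝ} (hx0 : 0 < x) (hx1 : x < 1) (hp0 : 0 < p) (hp1 : p < 1)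
    (hne : p ≠ x) : 0 < relEnt x p := by
  have h1 : 0 < 1 - x := by linarith
  have h2 : 0 < 1 - p := by linarith
  have h3 : 0 < (p - x) ^ 2 := by
    have := sub_ne_zero.2 hne
    positivity
  rcases lt_or_gt_of_ne hne with h | h
  · have := (relEnt_compare_right hx0 hx1 hp0 hp1).1 h.le
    have h4 : 0 < (1 - x) * (p - x) ^ 2 / (2 * x * (1 - p) ^ 2) := by positivity
    linarith
  · have := (relEnt_compare_left hx0 hx1 hp0 hp1).2 h.le
    have h4 : 0 < (p - x) ^ 2 / (2 * p * (1 - x)) := by positivity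
    linarith

/-- The relative entropy, normalised by `(p - x) ^ 2 / (1 - p) ^ 2`. Up to a monotone
transformation this is the ratio of the `p`-derivatives of a binomial tail and of its Gaussian
approximation. -/
noncomputable def entRatio (x p : ℝ) : ℝ := (1 - p) ^ 2 * relEnt x p / (p - x) ^ 2

theorem entRatio_pos {x p : ℝ} (hx0 : 0 < x) (hx1 : x < 1) (hp0 : 0 < p) (hp1 : p < 1)
    (hne : p ≠ x) : 0 < entRatio x p := by
  have h2 : 0 < 1 - p := by linarith
  have h3 : 0 < (p - x) ^ 2 := by
    have := sub_ne_zero.2 hne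
    positivity
  have := relEnt_pos hx0 hx1 hp0 hp1 hne
  unfold entRatio
  positivity

theorem hasDerivAt_entRatio {x p : ℝ} (hx0 : 0 < x) (hx1 : x < 1) (hp0 : 0 < p) (hp1 : p < 1)
    (hne : p ≠ x) : HasDerivAt (entRatio x)
      (-(2 * (1 - x) * (1 - p) * (relEnt x p - (p - x) ^ 2 / (2 * p * (1 - x))) / (p - x) ^ 3)) p := by
  have h1 : 1 - x ≠ 0 := by linarith
  have h2 : 1 - p ≠ 0 := by linarith
  have h3 : p - x ≠ 0 := sub_ne_zero.2 hne
  have hn : HasDerivAt (fun q : ℝ => (1 - q) ^ 2) (-(2 * (1 - p))) p := by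
    simpa using ((hasDerivAt_id p).const_sub 1).fun_pow 2
  have hd : HasDerivAt (fun q : ℝ => (q - x) ^ 2) (2 * (p - x)) p := by
    simpa using ((hasDerivAt_id p).sub_const x).fun_pow 2
  refine ((hn.mul (hasDerivAt_relEnt hx0 hx1 hp0 hp1)).div hd (by positivity)).congr_deriv ?_
  simp only [Pi.mul_apply]
  field_simp
  ring

theorem entRatio_antitone {x p q : ℝ} (hx0 : 0 < x) (hx1 : x < 1) (hp0 : 0 < p) (hpq : p < q)
    (hq1 : q < 1) (hpx : p ≠ x) (hqx : q ≠ x) : entRatio x q ≤ entRatio x p := by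
  have h1 : 0 < 1 - x := by linarith
  have key : ∀ a b : ℝ, 0 ≤ a → b ≤ 1 → (∀ r ∈ Set.Ioo a b, r ≠ x) → p ∈ Set.Ioo a b →
      q ∈ Set.Ioo a b → entRatio x q ≤ entRatio x p := by
    intro a b ha hb hr hp hq
    have hder : ∀ r ∈ Set.Ioo a b, HasDerivAt (entRatio x) _ r := fun r h =>
      hasDerivAt_entRatio hx0 hx1 (ha.trans_lt h.1) (h.2.trans_le hb) (hr r h)
    refine antitoneOn_of_deriv_nonpos (convex_Ioo a b)
      (fun r h => (hder r h).continuousAt.continuousWithinAt) ?_ ?_ hp hq hpq.le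
    · rw [interior_Ioo]
      exact fun r h => (hder r h).differentiableAt.differentiableWithinAt
    · rw [interior_Ioo]
      intro r h
      have hr0 := ha.trans_lt h.1
      have hr1 := h.2.trans_le hb
      have h2 : 0 < 1 - r := by linarith
      rw [(hder r h).deriv, neg_nonpos]
      rcases lt_or_gt_of_ne (hr r h) with hlt | hgt
      · refine div_nonneg_of_nonpos (mul_nonpos_of_nonneg_of_nonpos (by positivity)
          ((relEnt_compare_left hx0 hx1 hr0 hr1).1 hlt.le)) ?_
        have : r - x ≤ 0 := by linarith
        exact (Odd.pow_nonpos (by decide) this)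
      · have : 0 < r - x := by linarith
        exact div_nonneg (mul_nonneg (by positivity)
          ((relEnt_compare_left hx0 hx1 hr0 hr1).2 hgt.le)) (by positivity)
  have hp1 : p < 1 := hpq.trans hq1
  have hq0 : 0 < q := hp0.trans hpq
  rcases lt_or_gt_of_ne hqx with hq | hq
  · exact key 0 x le_rfl hx1.le (fun r h => h.2.ne) ⟨hp0, hpq.trans hq⟩ ⟨hq0, hq⟩
  rcases lt_or_gt_of_ne hpx with hp | hp
  · -- On opposite sides of `x` the common limit `(1 - x) / (2 * x)` at `x` separates the values.
    have h2 : 0 < 1 - p := by linarith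
    have h3 : 0 < 1 - q := by linarith
    have h4 : 0 < (p - x) ^ 2 := by
      have := sub_ne_zero.2 hpx
      positivity
    have h5 : 0 < (q - x) ^ 2 := by
      have := sub_ne_zero.2 hqx
      positivity
    calc entRatio x q ≤ (1 - x) / (2 * x) := by
          have := (relEnt_compare_right hx0 hx1 hq0 hq1).2 hq.le
          rw [sub_nonneg, le_div_iff₀ (by positivity)] at this
          rw [entRatio, div_le_div_iff₀ h5 (by positivity)]
          linarith
      _ ≤ entRatio x p := by
          have := (relEnt_compare_right hx0 hx1 hp0 hp1).1 hp.le
          rw [sub_nonpos, div_le_iff₀ (by positivity)] at this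
          rw [entRatio, div_le_div_iff₀ (by positivity) h4]
          linarith
  · exact key x 1 hx0.le le_rfl (fun r h => h.1.ne') ⟨hp, hp1⟩ ⟨hp.trans hpq, hq1⟩

/-! ### The standard normal distribution function -/

theorem hasDerivAt_cdf_gaussian (t : ℝ) :
    HasDerivAt (cdf (gaussianReal 0 1)) (gaussianPDFReal 0 1 t) t := by
  have hcont : Continuous (gaussianPDFReal 0 1) := by
    unfold gaussianPDFReal
    fun_prop
  have hint := integrable_gaussianPDFReal 0 1
  have heq : ∀ s, cdf (gaussianReal 0 1) s =
      cdf (gaussianReal 0 1) 0 + ∫ y in (0 : ℝ)..s, gaussianPDFReal 0 1 y := by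
    have h : ∀ s, cdf (gaussianReal 0 1) s = ∫ y in Set.Iic s, gaussianPDFReal 0 1 y := by
      intro s
      rw [cdf_eq_real, measureReal_def, gaussianReal_apply_eq_integral _ one_ne_zero,
        ENNReal.toReal_ofReal (integral_nonneg fun y => gaussianPDFReal_nonneg _ _ _)]
    intro s
    rw [h, h, ← intervalIntegral.integral_Iic_sub_Iic hint.integrableOn hint.integrableOn]
    ring
  rw [show (cdf (gaussianReal 0 1) : ℝ → ℝ) = _ from funext heq]
  exact (intervalIntegral.integral_hasDerivAt_right (hint.intervalIntegrable)
    hcont.stronglyMeasurable.stronglyMeasurableAtFilter hcont.continuousAt).const_add _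

theorem gaussianPDFReal_std (t : ℝ) :
    gaussianPDFReal 0 1 t = (Real.sqrt (2 * Real.pi))⁻¹ * Real.exp (-(t ^ 2 / 2)) := by
  simp [gaussianPDFReal, neg_div]

theorem cdf_gaussian_neg (t : ℝ) :
    cdf (gaussianReal 0 1) (-t) = 1 - (gaussianReal 0 1).real (Set.Iio t) := by
  have h : (gaussianReal 0 1).map (fun y => -y) = gaussianReal 0 1 := by
    simpa using gaussianReal_map_neg (μ := 0) (v := 1)
  rw [← probReal_compl_eq_one_sub measurableSet_Iio, cdf_eq_real]
  conv_lhs => rw [← h]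
  rw [map_measureReal_apply measurable_neg measurableSet_Iic]
  congr 1
  ext y
  simp

theorem cdf_gaussian_neg_eq (t : ℝ) :
    cdf (gaussianReal 0 1) (-t) = 1 - cdf (gaussianReal 0 1) t := by
  have := nullSingletonClass_gaussianReal (μ := 0) (v := 1) one_ne_zero
  rw [cdf_gaussian_neg, cdf_eq_real, measureReal_congr Iio_ae_eq_Iic]

theorem cdf_gaussian_neg_le_exp {t : ℝ} (ht : 0 ≤ t) :
    cdf (gaussianReal 0 1) (-t) ≤ Real.exp (-(t ^ 2 / 2)) := by
  have hsub : HasSubgaussianMGF id 1 (gaussianReal 0 1) :=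
    ⟨fun s => integrable_exp_mul_gaussianReal s, fun s => by
      rw [mgf_id_gaussianReal]
      simp⟩
  have := hsub.measure_ge_le ht
  rw [cdf_gaussian_neg, ← probReal_compl_eq_one_sub measurableSet_Iio, Set.compl_Iio]
  rw [← neg_div]
  simpa using! this

theorem isLeast_normalUpperQuantile {β : ℝ} (h0 : 0 < β) (h1 : β < 1) :
    IsLeast {z : ℝ | 1 - β ≤ cdf (gaussianReal 0 1) z}
      (normalUpperQuantile β) := by
  have hne : {z : ℝ | 1 - β ≤ cdf (gaussianReal 0 1) z}.Nonempty :=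
    ((tendsto_cdf_atTop (gaussianReal 0 1)).eventually_const_le (show 1 - β < 1 by linarith)).exists
  have hbd : BddBelow {z : ℝ | 1 - β ≤ cdf (gaussianReal 0 1) z} := by
    obtain ⟨b, hb⟩ := ((tendsto_cdf_atBot (gaussianReal 0 1)).eventually_lt_const
      (show 0 < 1 - β by linarith)).exists
    refine ⟨b, fun z hz => ?_⟩
    by_contra! h
    exact absurd (hz.trans (monotone_cdf _ h.le)) (not_le.2 hb)
  have hcl : IsClosed {z : ℝ | 1 - β ≤ cdf (gaussianReal 0 1) z} :=
    isClosed_le continuous_const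
      (continuous_iff_continuousAt.2 fun t => (hasDerivAt_cdf_gaussian t).continuousAt)
  exact ⟨hcl.csInf_mem hne hbd, fun z hz => csInf_le hbd hz⟩

/-! ### The Zubkov–Serov inequality -/

/-- `P(Y < k)` for `Y ∼ Bin(n, p)`, as a polynomial in `p`. -/
noncomputable def binLower (n k : ℕ) (p : ℝ) : ℝ :=
  ∑ i ∈ Finset.range k, (n.choose i : ℝ) * p ^ i * (1 - p) ^ (n - i)

theorem hasDerivAt_binLower (n k : ℕ) (p : ℝ) :
    HasDerivAt (binLower n k) (-((n.choose k : ℝ) * k * p ^ (k - 1) * (1 - p) ^ (n - k))) p := by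
  induction k with
  | zero =>
    have h : binLower n 0 = fun _ => 0 := by
      funext q
      simp [binLower]
    rw [h]
    simpa using hasDerivAt_const p (0 : ℝ)
  | succ k ih =>
    have h : binLower n (k + 1) =
        fun q => binLower n k q + (n.choose k : ℝ) * q ^ k * (1 - q) ^ (n - k) := by
      funext q
      simp [binLower, Finset.sum_range_succ]
    have h1 : HasDerivAt (fun q : ℝ => (1 - q) ^ (n - k))
        (((n - k : ℕ) : ℝ) * (1 - p) ^ (n - k - 1) * (-1)) p :=
      ((hasDerivAt_id p).const_sub 1).fun_pow (n - k)
    rw [h]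
    refine (ih.fun_add (((hasDerivAt_pow k p).const_mul (n.choose k : ℝ)).fun_mul h1)).congr_deriv ?_
    have hc : (n.choose (k + 1) : ℝ) * (k + 1 : ℕ) = n.choose k * (n - k : ℕ) := by
      exact_mod_cast Nat.choose_succ_right_eq n k
    rw [hc, Nat.add_sub_cancel, Nat.sub_add_eq]
    ring

theorem binLower_at_zero {n k : ℕ} (hk : 0 < k) : binLower n k 0 = 1 := by
  rw [binLower, Finset.sum_eq_single 0]
  · simp
  · intro i _ hi
    simp [hi]
  · simp [hk.ne']

theorem binLower_at_one {n k : ℕ} (hk : k ≤ n) : binLower n k 1 = 0 := by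
  refine Finset.sum_eq_zero fun i hi => ?_
  have : n - i ≠ 0 := by
    have := Finset.mem_range.1 hi
    omega
  simp [this]

theorem binLower_antitoneOn (n k : ℕ) : AntitoneOn (binLower n k) (Set.Icc 0 1) := by
  refine antitoneOn_of_deriv_nonpos (convex_Icc 0 1)
    (fun q _ => (hasDerivAt_binLower n k q).continuousAt.continuousWithinAt)
    (fun q _ => (hasDerivAt_binLower n k q).differentiableAt.differentiableWithinAt) ?_
  intro q hq
  rw [interior_Icc] at hq
  have h0 := hq.1
  have h1 : 0 < 1 - q := by linarith [hq.2]
  rw [(hasDerivAt_binLower n k q).deriv, neg_nonpos]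
  positivity

/-- A continuous function on `(0, 1)` that tends to `0` at both ends, and whose derivative changes
sign at most once, from nonnegative to negative, is nonnegative. One exceptional point `x` without
a derivative is allowed. -/
theorem nonneg_of_deriv_sign_change {f f' : ℝ → ℝ} {x : ℝ}
    (hc : ContinuousOn f (Set.Ioo 0 1))
    (hd : ∀ p ∈ Set.Ioo (0 : ℝ) 1, p ≠ x → HasDerivAt f (f' p) p)
    (hsign : ∀ p q : ℝ, 0 < p → p < q → q < 1 → p ≠ x → q ≠ x → 0 ≤ f' q → 0 ≤ f' p)
    (h0 : Filter.Tendsto f (nhdsWithin 0 (Set.Ioi 0)) (nhds 0))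
    (h1 : Filter.Tendsto f (nhdsWithin 1 (Set.Iio 1)) (nhds 0))
    {p : ℝ} (hp : p ∈ Set.Ioo (0 : ℝ) 1) (hpx : p ≠ x) : 0 ≤ f p := by
  have mono : ∀ g g' : ℝ → ℝ, ContinuousOn g (Set.Ioo 0 1) → ∀ a b : ℝ, 0 < a → a ≤ b → b < 1 →
      (∀ r ∈ Set.Ioo a b, r ≠ x → HasDerivAt g (g' r) r ∧ 0 ≤ g' r) → g a ≤ g b := by
    intro g g' hgc
    have basic : ∀ a b : ℝ, 0 < a → a ≤ b → b < 1 →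
        (∀ r ∈ Set.Ioo a b, HasDerivAt g (g' r) r ∧ 0 ≤ g' r) → g a ≤ g b := by
      intro a b ha hab hb hr
      refine monotoneOn_of_deriv_nonneg (convex_Icc a b)
        (hgc.mono fun r hr => ⟨ha.trans_le hr.1, hr.2.trans_lt hb⟩) ?_ ?_
        (Set.left_mem_Icc.2 hab) (Set.right_mem_Icc.2 hab) hab
      · rw [interior_Icc]
        exact fun r h => (hr r h).1.differentiableAt.differentiableWithinAt
      · rw [interior_Icc]
        intro r h
        rw [(hr r h).1.deriv]
        exact (hr r h).2
    intro a b ha hab hb hr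
    by_cases hx : x ∈ Set.Ioo a b
    · exact (basic a x ha hx.1.le (hx.2.trans hb)
        fun r h => hr r ⟨h.1, h.2.trans hx.2⟩ h.2.ne).trans
        (basic x b (ha.trans hx.1) hx.2.le hb fun r h => hr r ⟨hx.1.trans h.1, h.2⟩ h.1.ne')
    · exact basic a b ha hab hb fun r h => hr r h fun hrx => hx (hrx ▸ h)
  rcases le_or_gt 0 (f' p) with hsgn | hsgn
  · refine le_of_tendsto h0 ?_
    filter_upwards [Ioo_mem_nhdsGT hp.1] with r hr
    refine mono f f' hc r p hr.1 hr.2.le hp.2 fun s hs hsx => ?_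
    have hs0 := hr.1.trans hs.1
    exact ⟨hd s ⟨hs0, hs.2.trans hp.2⟩ hsx, hsign s p hs0 hs.2 hp.2 hsx hpx hsgn⟩
  · refine le_of_tendsto h1 ?_
    filter_upwards [Ioo_mem_nhdsLT hp.2] with r hr
    refine neg_le_neg_iff.1 (mono (fun t => -f t) (fun t => -f' t) hc.neg p r hp.1 hr.1.le hr.2
      fun s hs hsx => ?_)
    have hs0 := hp.1.trans hs.1
    have hs1 := hs.2.trans hr.2
    refine ⟨(hd s ⟨hs0, hs1⟩ hsx).neg, ?_⟩
    by_contra! hcon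
    exact absurd (hsign p s hp.1 hs.1 hs1 hpx hsx (by linarith)) (not_le.2 hsgn)

theorem relEnt_compl (x p : ℝ) : relEnt (1 - x) (1 - p) = relEnt x p := by
  simp only [relEnt, sub_sub_cancel]
  ring

theorem tendsto_relEnt_zero {x : ℝ} (hx0 : 0 < x) (hx1 : x < 1) :
    Filter.Tendsto (relEnt x) (nhdsWithin 0 (Set.Ioi 0)) Filter.atTop := by
  have h1 : 1 - x ≠ 0 := by linarith
  have ha : Filter.Tendsto (fun p : ℝ => x * Real.log (x / p)) (nhdsWithin 0 (Set.Ioi 0))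
      Filter.atTop :=
    (Real.tendsto_log_atTop.comp (tendsto_inv_nhdsGT_zero.const_mul_atTop hx0)).const_mul_atTop hx0
  have hb : ContinuousAt (fun p : ℝ => (1 - x) * Real.log ((1 - x) / (1 - p))) 0 := by
    refine ContinuousAt.mul continuousAt_const (ContinuousAt.log ?_ (by simpa using h1))
    exact ContinuousAt.div continuousAt_const (by fun_prop) (by simp)
  exact Filter.Tendsto.atTop_add ha (hb.tendsto.mono_left nhdsWithin_le_nhds)

theorem tendsto_relEnt_one {x : ℝ} (hx0 : 0 < x) (hx1 : x < 1) :
    Filter.Tendsto (relEnt x) (nhdsWithin 1 (Set.Iio 1)) Filter.atTop := by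
  have h : relEnt x = fun p => relEnt (1 - x) (1 - p) := funext fun p => (relEnt_compl x p).symm
  rw [h]
  refine (tendsto_relEnt_zero (by linarith) (by linarith)).comp ?_
  refine tendsto_nhdsWithin_iff.2 ⟨?_, ?_⟩
  · have : Filter.Tendsto (fun p : ℝ => 1 - p) (nhds 1) (nhds (1 - 1)) :=
      tendsto_const_nhds.sub Filter.tendsto_id
    rw [sub_self] at this
    exact this.mono_left nhdsWithin_le_nhds
  · filter_upwards [self_mem_nhdsWithin] with p hp
    simpa using hp

/-- The signed root `± √(2 n · relEnt x p)` of the likelihood-ratio statistic, negative for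
`p < x`. -/
noncomputable def signedRoot (n : ℕ) (x p : ℝ) : ℝ :=
  if p < x then -Real.sqrt (2 * n * relEnt x p) else Real.sqrt (2 * n * relEnt x p)

theorem signedRoot_sq {n : ℕ} {x p : ℝ} (h : 0 ≤ relEnt x p) :
    signedRoot n x p ^ 2 = 2 * n * relEnt x p := by
  unfold signedRoot
  split_ifs
  · rw [neg_sq]
    exact Real.sq_sqrt (by positivity)
  · exact Real.sq_sqrt (by positivity)

theorem hasDerivAt_signedRoot {n : ℕ} (hn : 0 < n) {x p : ℝ} (hx0 : 0 < x) (hx1 : x < 1)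
    (hp0 : 0 < p) (hp1 : p < 1) (hne : p ≠ x) :
    HasDerivAt (signedRoot n x) (n / (p * Real.sqrt (2 * n * entRatio x p))) p := by
  have h2 : 0 < 1 - p := by linarith
  have hn' : (0 : ℝ) < n := by exact_mod_cast hn
  have hS := entRatio_pos hx0 hx1 hp0 hp1 hne
  have hD := relEnt_pos hx0 hx1 hp0 hp1 hne
  have hr : 0 < Real.sqrt (2 * n * entRatio x p) := Real.sqrt_pos.2 (by positivity)
  have hpx : p - x ≠ 0 := sub_ne_zero.2 hne
  have habs : 0 < |p - x| := abs_pos.2 hpx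
  have hsq : Real.sqrt (2 * n * relEnt x p) =
      |p - x| / (1 - p) * Real.sqrt (2 * n * entRatio x p) := by
    have h : 2 * n * relEnt x p = (|p - x| / (1 - p)) ^ 2 * (2 * n * entRatio x p) := by
      rw [div_pow, sq_abs, entRatio]
      field_simp
    rw [h, Real.sqrt_mul (by positivity), Real.sqrt_sq (by positivity)]
  have hroot := ((hasDerivAt_relEnt hx0 hx1 hp0 hp1).const_mul (2 * (n : ℝ))).sqrt
    (by positivity : 2 * n * relEnt x p ≠ 0)
  rw [hsq] at hroot
  rcases lt_or_gt_of_ne hne with h | h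
  · have he : signedRoot n x =ᶠ[nhds p] fun q => -Real.sqrt (2 * n * relEnt x q) := by
      filter_upwards [Iio_mem_nhds h] with q hq
      exact if_pos hq
    refine (hroot.neg.congr_of_eventuallyEq he).congr_deriv ?_
    rw [abs_of_neg (by linarith)] at habs ⊢
    have : x - p ≠ 0 := by linarith
    field_simp
  · have he : signedRoot n x =ᶠ[nhds p] fun q => Real.sqrt (2 * n * relEnt x q) := by
      filter_upwards [Ioi_mem_nhds h] with q hq
      exact if_neg (not_lt.2 (le_of_lt hq))
    refine (hroot.congr_of_eventuallyEq he).congr_deriv ?_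
    rw [abs_of_pos (by linarith)] at habs ⊢
    field_simp

theorem continuousAt_signedRoot {n : ℕ} (hn : 0 < n) {x p : ℝ} (hx0 : 0 < x) (hx1 : x < 1)
    (hp0 : 0 < p) (hp1 : p < 1) : ContinuousAt (signedRoot n x) p := by
  by_cases hne : p = x
  · subst hne
    have hs : Filter.Tendsto (fun q => Real.sqrt (2 * n * relEnt p q)) (nhds p) (nhds 0) := by
      have h : ContinuousAt (fun q => Real.sqrt (2 * n * relEnt p q)) p :=
        Real.continuous_sqrt.continuousAt.comp
          (continuousAt_const.mul (hasDerivAt_relEnt hp0 hp1 hp0 hp1).continuousAt)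
      simpa [ContinuousAt, relEnt_self hp0 hp1] using h
    have h0 : signedRoot n p p = 0 := by simp [signedRoot, relEnt_self hp0 hp1]
    rw [ContinuousAt, h0]
    refine squeeze_zero_norm (fun q => ?_) hs
    unfold signedRoot
    split_ifs <;> simp [abs_of_nonneg (Real.sqrt_nonneg _)]
  · exact (hasDerivAt_signedRoot hn hx0 hx1 hp0 hp1 hne).continuousAt

/-- Tilting identity: `Bin(n, p)` weighs the value `k` as `Bin(n, k / n)` does, up to the
likelihood ratio, which is a Gaussian factor in the signed root. -/
theorem exp_neg_half_signedRoot_sq {n k : ℕ} (hk : 0 < k) (hkn : k < n) {x p : ℝ}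
    (hx : x = k / n) (hp0 : 0 < p) (hp1 : p < 1) (hne : p ≠ x) :
    p ^ k * (1 - p) ^ (n - k) =
      x ^ k * (1 - x) ^ (n - k) * Real.exp (-(signedRoot n x p ^ 2 / 2)) := by
  have hn' : (0 : ℝ) < n := by exact_mod_cast hk.trans hkn
  have hx0 : 0 < x := by
    rw [hx]
    positivity
  have hx1 : x < 1 := by
    rw [hx, div_lt_one hn']
    exact_mod_cast hkn
  have h1 : 0 < 1 - x := by linarith
  have h2 : 0 < 1 - p := by linarith
  rw [signedRoot_sq (relEnt_pos hx0 hx1 hp0 hp1 hne).le]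
  have hnx : (n : ℝ) * x = k := by
    rw [hx]
    field_simp
  have hnx' : (n : ℝ) * (1 - x) = (n - k : ℕ) := by
    rw [Nat.cast_sub hkn.le, mul_sub, hnx, mul_one]
  have he : -(2 * n * relEnt x p / 2) =
      k * Real.log (p / x) + (n - k : ℕ) * Real.log ((1 - p) / (1 - x)) := by
    rw [← hnx', relEnt, Real.log_div hx0.ne' hp0.ne', Real.log_div hp0.ne' hx0.ne',
      Real.log_div h1.ne' h2.ne', Real.log_div h2.ne' h1.ne', ← hnx]
    ring
  rw [he, Real.exp_add, ← Real.log_pow, ← Real.log_pow, Real.exp_log (by positivity),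
    Real.exp_log (by positivity), div_pow, div_pow]
  field_simp

/-- The **Zubkov–Serov inequality**: the binomial tail `P(Y ≥ k)` is at least the Gaussian
distribution function at the signed root of the likelihood-ratio statistic. Both sides vanish at
`p = 0` and equal `1` at `p = 1`, and the derivative of their difference in `p` is, up to a positive
factor, an increasing function of the antitone quantity `entRatio`. -/
theorem cdf_signedRoot_le_one_sub_binLower {n k : ℕ} (hk : 0 < k) (hkn : k < n) {p : ℝ}
    (hp0 : 0 < p) (hp1 : p < 1) (hne : p ≠ k / n) :
    cdf (gaussianReal 0 1) (signedRoot n (k / n) p) ≤ 1 - binLower n k p := by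
  have hn : 0 < n := hk.trans hkn
  have hn' : (0 : ℝ) < n := by exact_mod_cast hn
  obtain ⟨x, hx⟩ : ∃ x : ℝ, x = k / n := ⟨_, rfl⟩
  rw [← hx] at hne ⊢
  have hx0 : 0 < x := by
    rw [hx]
    positivity
  have hx1 : x < 1 := by
    rw [hx, div_lt_one hn']
    exact_mod_cast hkn
  set w : ℝ → ℝ := fun q => Real.exp (-(signedRoot n x q ^ 2 / 2)) with hw
  set A : ℝ := n.choose k * k * (x ^ k * (1 - x) ^ (n - k)) with hA
  rw [← sub_nonneg]
  refine nonneg_of_deriv_sign_change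
    (f := fun q => 1 - binLower n k q - cdf (gaussianReal 0 1) (signedRoot n x q))
    (f' := fun q => w q / q *
      (A - (Real.sqrt (2 * Real.pi))⁻¹ * (n / Real.sqrt (2 * n * entRatio x q))))
    (x := x) ?_ ?_ ?_ ?_ ?_ ⟨hp0, hp1⟩ hne
  · intro q hq
    refine ContinuousAt.continuousWithinAt (ContinuousAt.sub
      (continuousAt_const.sub (hasDerivAt_binLower n k q).continuousAt) ?_)
    exact ContinuousAt.comp (hasDerivAt_cdf_gaussian _).continuousAt
      (continuousAt_signedRoot hn hx0 hx1 hq.1 hq.2)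
  · intro q hq hqx
    refine (((hasDerivAt_binLower n k q).const_sub 1).sub ((hasDerivAt_cdf_gaussian _).comp q
      (hasDerivAt_signedRoot hn hx0 hx1 hq.1 hq.2 hqx))).congr_deriv ?_
    have hq0 := hq.1
    have hS := entRatio_pos hx0 hx1 hq.1 hq.2 hqx
    have hr : 0 < Real.sqrt (2 * n * entRatio x q) := Real.sqrt_pos.2 (by positivity)
    have hpow : q ^ (k - 1) * (1 - q) ^ (n - k) = x ^ k * (1 - x) ^ (n - k) * w q / q := by
      rw [hw, ← exp_neg_half_signedRoot_sq hk hkn hx hq.1 hq.2 hqx, eq_div_iff hq0.ne']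
      calc q ^ (k - 1) * (1 - q) ^ (n - k) * q = q ^ (k - 1 + 1) * (1 - q) ^ (n - k) := by ring
        _ = _ := by rw [Nat.sub_add_cancel hk]
    rw [gaussianPDFReal_std, neg_neg, mul_assoc, hpow, hA]
    change _ - (Real.sqrt (2 * Real.pi))⁻¹ * w q * _ = _
    field_simp
  · -- A nonnegative derivative at `q` stays nonnegative at `p < q`, as `entRatio` grows leftwards.
    intro p q hp hpq hq hpx hqx hsgn
    have hq0 := hp.trans hpq
    have hSq := entRatio_pos hx0 hx1 hq0 hq hqx
    have hle := entRatio_antitone hx0 hx1 hp hpq hq hpx hqx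
    have hwq : 0 < w q / q := div_pos (Real.exp_pos _) hq0
    have hwp : 0 < w p / p := div_pos (Real.exp_pos _) hp
    refine mul_nonneg hwp.le ((nonneg_of_mul_nonneg_right hsgn hwq).trans ?_)
    have hr : 0 < Real.sqrt (2 * n * entRatio x q) := Real.sqrt_pos.2 (by positivity)
    gcongr
  · have h1 : Filter.Tendsto (binLower n k) (nhdsWithin 0 (Set.Ioi 0)) (nhds 1) := by
      rw [← binLower_at_zero (n := n) hk]
      exact (hasDerivAt_binLower n k 0).continuousAt.tendsto.mono_left nhdsWithin_le_nhds
    have h2 : Filter.Tendsto (signedRoot n x) (nhdsWithin 0 (Set.Ioi 0)) Filter.atBot := by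
      have h := Filter.tendsto_neg_atTop_atBot.comp (Real.tendsto_sqrt_atTop.comp
        ((tendsto_relEnt_zero hx0 hx1).const_mul_atTop (by positivity : (0 : ℝ) < 2 * n)))
      refine h.congr' ?_
      filter_upwards [Ioo_mem_nhdsGT hx0] with q hq
      simp [signedRoot, hq.2]
    simpa using (h1.const_sub 1).sub ((tendsto_cdf_atBot (gaussianReal 0 1)).comp h2)
  · have h1 : Filter.Tendsto (binLower n k) (nhdsWithin 1 (Set.Iio 1)) (nhds 0) := by
      rw [← binLower_at_one hkn.le]
      exact (hasDerivAt_binLower n k 1).continuousAt.tendsto.mono_left nhdsWithin_le_nhds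
    have h2 : Filter.Tendsto (signedRoot n x) (nhdsWithin 1 (Set.Iio 1)) Filter.atTop := by
      have h := Real.tendsto_sqrt_atTop.comp
        ((tendsto_relEnt_one hx0 hx1).const_mul_atTop (by positivity : (0 : ℝ) < 2 * n))
      refine h.congr' ?_
      filter_upwards [Ioo_mem_nhdsLT hx1] with q hq
      simp [signedRoot, not_lt.2 hq.1.le]
    simpa using (h1.const_sub 1).sub ((tendsto_cdf_atTop (gaussianReal 0 1)).comp h2)

/-! ### Bounds on the entropy at a fair coin -/

/-- Pinsker's inequality for a fair coin. -/
theorem two_mul_sq_le_relEnt {x : ℝ} (hx : 1 / 2 ≤ x) (hx1 : x < 1) :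
    2 * (x - 1 / 2) ^ 2 ≤ relEnt x (1 / 2) := by
  have hx0 : 0 < x := by linarith
  have hd : ∀ q ∈ Set.Icc (1 / 2) x, HasDerivAt (fun q => relEnt x q - 2 * (q - x) ^ 2)
      ((q - x) / (q * (1 - q)) - 2 * (2 * (q - x))) q := by
    intro q hq
    have hn : HasDerivAt (fun q : ℝ => (q - x) ^ 2) (2 * (q - x)) q := by
      simpa using ((hasDerivAt_id q).sub_const x).fun_pow 2
    exact (hasDerivAt_relEnt hx0 hx1 (by linarith [hq.1]) (by linarith [hq.2])).sub
      (hn.const_mul 2)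
  have hanti : AntitoneOn (fun q => relEnt x q - 2 * (q - x) ^ 2) (Set.Icc (1 / 2) x) := by
    refine antitoneOn_of_deriv_nonpos (convex_Icc _ _)
      (fun q hq => (hd q hq).continuousAt.continuousWithinAt)
      (fun q hq => (hd q (interior_subset hq)).differentiableAt.differentiableWithinAt) ?_
    intro q hq
    have hq := interior_subset hq
    have h0 : 0 < q := by linarith [hq.1]
    have h1 : 0 < 1 - q := by linarith [hq.2]
    rw [(hd q hq).deriv, show (q - x) / (q * (1 - q)) - 2 * (2 * (q - x)) =
      (q - x) * ((2 * q - 1) ^ 2 / (q * (1 - q))) by field_simp; ring]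
    exact mul_nonpos_of_nonpos_of_nonneg (by linarith [hq.2]) (by positivity)
  have := hanti (Set.left_mem_Icc.2 hx) (Set.right_mem_Icc.2 hx) hx
  simp only [relEnt_self hx0 hx1] at this
  nlinarith

theorem relEnt_half (u : ℝ) :
    2 * relEnt ((1 + u) / 2) (1 / 2) =
      (1 + u) * Real.log (1 + u) + (1 - u) * Real.log (1 - u) := by
  rw [relEnt, show (1 + u) / 2 / (1 / 2) = 1 + u by ring,
    show (1 - (1 + u) / 2) / (1 - 1 / 2) = 1 - u by ring]
  ring

/-- Up to `7 / 9` the difference of the two sides is nondecreasing: its derivative is nondecreasing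
and vanishes at `0`. At `7 / 9` the values of the logarithm reduce to `log 2` and `log 3`, as
`entropy_le_of_ge` needs. -/
theorem entropy_le_of_le {u : ℝ} (hu0 : 0 ≤ u) (hu1 : u ≤ 7 / 9) :
    (1 + u) * Real.log (1 + u) + (1 - u) * Real.log (1 - u) ≤ (u + u ^ 3 / 5) ^ 2 := by
  have hlog : ∀ t ∈ Set.Icc (0 : ℝ) (7 / 9), HasDerivAt (fun t => Real.log (1 + t))
      (1 / (1 + t)) t := fun t ht =>
    ((hasDerivAt_id t).const_add 1).log (by simp only [id]; linarith [ht.1])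
  have hlog' : ∀ t ∈ Set.Icc (0 : ℝ) (7 / 9), HasDerivAt (fun t => Real.log (1 - t))
      (-1 / (1 - t)) t := fun t ht =>
    ((hasDerivAt_id t).const_sub 1).log (by simp only [id]; linarith [ht.2])
  have hpoly : ∀ t : ℝ, HasDerivAt (fun t : ℝ => 2 * t + 8 / 5 * t ^ 3 + 6 / 25 * t ^ 5)
      (2 + 8 / 5 * (3 * t ^ 2) + 6 / 25 * (5 * t ^ 4)) t := fun t => by
    simpa using (((hasDerivAt_id t).const_mul 2).fun_add
      ((hasDerivAt_pow 3 t).const_mul (8 / 5))).fun_add ((hasDerivAt_pow 5 t).const_mul (6 / 25))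
  have hslope : MonotoneOn (fun t => 2 * t + 8 / 5 * t ^ 3 + 6 / 25 * t ^ 5 -
      (Real.log (1 + t) - Real.log (1 - t))) (Set.Icc 0 (7 / 9)) := by
    have hd := fun t ht => (hpoly t).fun_sub ((hlog t ht).fun_sub (hlog' t ht))
    refine monotoneOn_of_deriv_nonneg (convex_Icc _ _)
      (fun q hq => (hd q hq).continuousAt.continuousWithinAt)
      (fun q hq => (hd q (interior_subset hq)).differentiableAt.differentiableWithinAt) ?_
    intro t ht
    have ht := interior_subset ht
    have h1 : 0 < 1 - t := by linarith [ht.2]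
    have h2 : 0 < 1 + t := by linarith [ht.1]
    have hv : t ^ 2 ≤ 49 / 81 := by nlinarith [ht.1, ht.2]
    rw [(hd t ht).deriv, show 2 + 8 / 5 * (3 * t ^ 2) + 6 / 25 * (5 * t ^ 4) -
      (1 / (1 + t) - -1 / (1 - t)) =
        t ^ 2 * (14 / 5 - 18 / 5 * t ^ 2 - 6 / 5 * (t ^ 2) ^ 2) / ((1 + t) * (1 - t)) by
      field_simp; ring]
    have : 0 ≤ 14 / 5 - 18 / 5 * t ^ 2 - 6 / 5 * (t ^ 2) ^ 2 := by nlinarith [sq_nonneg t]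
    positivity
  have hmain : MonotoneOn (fun t => (t ^ 2 + 2 / 5 * t ^ 4 + 1 / 25 * t ^ 6) -
      ((1 + t) * Real.log (1 + t) + (1 - t) * Real.log (1 - t))) (Set.Icc 0 (7 / 9)) := by
    have hp : ∀ t : ℝ, HasDerivAt (fun t : ℝ => t ^ 2 + 2 / 5 * t ^ 4 + 1 / 25 * t ^ 6)
        (2 * t + 8 / 5 * t ^ 3 + 6 / 25 * t ^ 5) t := fun t => by
      refine (((hasDerivAt_pow 2 t).fun_add ((hasDerivAt_pow 4 t).const_mul (2 / 5))).fun_add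
        ((hasDerivAt_pow 6 t).const_mul (1 / 25))).congr_deriv ?_
      norm_num
      ring
    have hd := fun t ht => (hp t).fun_sub ((((hasDerivAt_id' t).const_add 1).fun_mul (hlog t ht)).fun_add
      (((hasDerivAt_id' t).const_sub 1).fun_mul (hlog' t ht)))
    refine monotoneOn_of_deriv_nonneg (convex_Icc _ _)
      (fun q hq => (hd q hq).continuousAt.continuousWithinAt)
      (fun q hq => (hd q (interior_subset hq)).differentiableAt.differentiableWithinAt) ?_
    intro t ht
    have ht := interior_subset ht
    have h1 : 1 - t ≠ 0 := by linarith [ht.2]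
    have h2 : 1 + t ≠ 0 := by linarith [ht.1]
    have h0 := hslope (Set.left_mem_Icc.2 (by norm_num)) ht ht.1
    rw [(hd t ht).deriv]
    field_simp
    norm_num at h0
    linarith
  have := hmain (Set.left_mem_Icc.2 (by norm_num)) ⟨hu0, hu1⟩ hu0
  norm_num at this
  nlinarith

/-- Beyond `7 / 9` the entropy lies below its chord, and the polynomial above its tangent
at `9 / 10`. -/
theorem entropy_le_of_ge {u : ℝ} (hu0 : 7 / 9 ≤ u) (hu1 : u ≤ 1) :
    (1 + u) * Real.log (1 + u) + (1 - u) * Real.log (1 - u) ≤ (u + u ^ 3 / 5) ^ 2 := by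
  have hconv := Real.convexOn_mul_log
  have ha : 0 ≤ 9 / 2 * (1 - u) := by linarith
  have hb : 0 ≤ 9 / 2 * (u - 7 / 9) := by linarith
  have c1 := hconv.2 (x := 16 / 9) (y := 2) (by norm_num) (by norm_num) ha hb (by ring)
  have c2 := hconv.2 (x := 2 / 9) (y := 0) (by norm_num) (by norm_num) ha hb (by ring)
  simp only [smul_eq_mul] at c1 c2
  rw [show 9 / 2 * (1 - u) * (16 / 9) + 9 / 2 * (u - 7 / 9) * 2 = 1 + u by ring] at c1
  rw [show 9 / 2 * (1 - u) * (2 / 9) + 9 / 2 * (u - 7 / 9) * 0 = 1 - u by ring] at c2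
  have l9 : Real.log 9 = 2 * Real.log 3 := by
    rw [show (9 : ℝ) = 3 ^ 2 by norm_num, Real.log_pow]
    norm_num
  have l16 : Real.log 16 = 4 * Real.log 2 := by
    rw [show (16 : ℝ) = 2 ^ 4 by norm_num, Real.log_pow]
    norm_num
  -- `2 ^ 19 = 524288` is just below `3 ^ 12 = 531441`.
  have l3 : 19 * Real.log 2 ≤ 12 * Real.log 3 := by
    have h := Real.log_le_log (by norm_num : (0 : ℝ) < 2 ^ 19)
      (by norm_num : (2 : ℝ) ^ 19 ≤ 3 ^ 12)
    rw [Real.log_pow, Real.log_pow] at h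
    exact_mod_cast h
  rw [Real.log_div (by norm_num) (by norm_num), l9, l16] at c1
  rw [Real.log_div (by norm_num) (by norm_num), l9] at c2
  have l2 := Real.log_two_lt_d9
  -- The tangent slope at `9 / 10` is `1 + 3 / 5 * (9 / 10) ^ 2 = 1.486`.
  have htan : 10458 / 10000 + 1486 / 1000 * (u - 9 / 10) ≤ u + u ^ 3 / 5 := by
    nlinarith [mul_nonneg (sq_nonneg (u - 9 / 10)) (by linarith : 0 ≤ u + 9 / 5)]
  have hsq : (10458 / 10000) ^ 2 + 2 * (10458 / 10000) * (1486 / 1000) * (u - 9 / 10) ≤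
      (u + u ^ 3 / 5) ^ 2 := by
    have h0 : 0 ≤ 10458 / 10000 + 1486 / 1000 * (u - 9 / 10) := by linarith
    nlinarith [pow_le_pow_left₀ h0 htan 2, sq_nonneg (u - 9 / 10)]
  have e1 : 16 / 9 * (4 * Real.log 2 - 2 * Real.log 3) + 2 / 9 * (Real.log 2 - 2 * Real.log 3) ≤
      694 / 1000 := by linarith
  have e2 := mul_le_mul_of_nonneg_left e1 ha
  have e3 := mul_le_mul_of_nonneg_left (show 2 * Real.log 2 ≤ 13863 / 10000 by linarith) hb
  nlinarith

theorem entropy_le {u : ℝ} (hu0 : 0 ≤ u) (hu1 : u ≤ 1) :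
    (1 + u) * Real.log (1 + u) + (1 - u) * Real.log (1 - u) ≤ (u + u ^ 3 / 5) ^ 2 := by
  rcases le_total u (7 / 9) with h | h
  · exact entropy_le_of_le hu0 h
  · exact entropy_le_of_ge h hu1

/-! ### Binomial tails and counts in independent samples -/

theorem binLower_add_reflect {n k : ℕ} (hk : k ≤ n + 1) (p : ℝ) :
    binLower n k p + binLower n (n + 1 - k) (1 - p) = 1 := by
  have htot : ∑ i ∈ Finset.range (n + 1), (n.choose i : ℝ) * p ^ i * (1 - p) ^ (n - i) = 1 := by
    have h := add_pow p (1 - p) n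
    rw [add_sub_cancel, one_pow] at h
    exact (Finset.sum_congr rfl fun i _ => by ring).trans h.symm
  have href : binLower n (n + 1 - k) (1 - p) =
      ∑ i ∈ Finset.Ico k (n + 1), (n.choose i : ℝ) * p ^ i * (1 - p) ^ (n - i) := by
    have h := Finset.sum_Ico_reflect (fun i => (n.choose i : ℝ) * p ^ i * (1 - p) ^ (n - i)) 0
      (show n + 1 - k ≤ n + 1 by omega)
    rw [Nat.sub_sub_self hk, Nat.sub_zero] at h
    rw [← h, binLower, Finset.range_eq_Ico]
    refine Finset.sum_congr rfl fun i hi => ?_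
    have := (Finset.mem_Ico.1 hi).2
    have hin : i ≤ n := by omega
    rw [Nat.choose_symm hin, sub_sub_cancel, Nat.sub_sub_self hin]
    ring
  rw [href, binLower, Finset.range_eq_Ico, Finset.sum_Ico_consecutive _ (Nat.zero_le k) hk,
    ← Finset.range_eq_Ico, htot]

theorem binTail_natCast (n k : ℕ) : binTail n k = 1 - binLower n k (1 / 2) := by
  have hset : {y : ℕ | (k : ℤ) ≤ (y : ℤ)} = (↑(Finset.range k) : Set ℕ)ᶜ := by
    ext y
    simp
  rw [binTail, hset, probReal_compl_eq_one_sub (Finset.measurableSet _),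
    ← sum_measureReal_singleton, binLower]
  congr 1
  exact Finset.sum_congr rfl fun i _ => binomial_real_singleton n i half

theorem binTail_eq (n : ℕ) (m : ℤ) : binTail n m = 1 - binLower n m.toNat (1 / 2) := by
  rw [← binTail_natCast]
  unfold binTail
  congr 1
  ext y
  simp

theorem binTail_antitone (n : ℕ) : Antitone (binTail n) := fun _ _ h =>
  measureReal_mono fun _ hy => le_trans h hy

/-- The number of coordinates falling into `S` has a binomial law under a product measure. -/
theorem pi_real_card_eq {n : ℕ} (F : Measure ℝ) [IsProbabilityMeasure F] {S : Set ℝ}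
    [DecidablePred (· ∈ S)] (hS : MeasurableSet S) (k : ℕ) :
    (Measure.pi fun _ : Fin n => F).real
        {x | (Finset.univ.filter fun i => x i ∈ S).card = k} =
      (n.choose k : ℝ) * F.real S ^ k * (1 - F.real S) ^ (n - k) := by
  have hset : {x : Fin n → ℝ | (Finset.univ.filter fun i => x i ∈ S).card = k} =
      ⋃ T ∈ (Finset.univ : Finset (Fin n)).powersetCard k,
        Set.univ.pi fun i => if i ∈ T then S else Sᶜ := by
    ext x
    simp only [Set.mem_ofPred_eq, Set.mem_iUnion, Finset.mem_powersetCard, Finset.subset_univ,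
      true_and, exists_prop, Set.mem_pi, Set.mem_univ, forall_const]
    constructor
    · intro h
      refine ⟨_, h, fun i => ?_⟩
      by_cases hi : x i ∈ S <;> simp [hi]
    · rintro ⟨T, hT, hx⟩
      rw [← hT]
      congr 1
      ext i
      have := hx i
      by_cases hi : i ∈ T <;> simpa [hi] using this
  rw [hset, measureReal_biUnion_finset]
  · have hterm : ∀ T ∈ (Finset.univ : Finset (Fin n)).powersetCard k,
        (Measure.pi fun _ : Fin n => F).real (Set.univ.pi fun i => if i ∈ T then S else Sᶜ) =
          F.real S ^ k * (1 - F.real S) ^ (n - k) := by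
      intro T hT
      have hT := (Finset.mem_powersetCard.1 hT).2
      rw [measureReal_def, Measure.pi_pi, ENNReal.toReal_prod]
      have h : ∀ i, (F (if i ∈ T then S else Sᶜ)).toReal =
          if i ∈ T then F.real S else 1 - F.real S := by
        intro i
        split_ifs
        · rfl
        · exact probReal_compl_eq_one_sub hS
      simp_rw [h]
      rw [Finset.prod_ite]
      simp [Finset.filter_not, ← Finset.compl_eq_univ_sdiff, Finset.card_compl, hT]
    rw [Finset.sum_congr rfl hterm, Finset.sum_const, Finset.card_powersetCard, Finset.card_univ,
      Fintype.card_fin, nsmul_eq_mul, mul_assoc]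
  · intro T _ U _ hTU
    refine Set.disjoint_left.2 fun x hx hy => hTU ?_
    ext i
    have h1 := hx i trivial
    have h2 := hy i trivial
    by_cases hi : i ∈ T <;> by_cases hj : i ∈ U <;> simp_all
  · intro T _
    refine MeasurableSet.univ_pi fun i => ?_
    split_ifs
    · exact hS
    · exact hS.compl

theorem measurableSet_card_eq {n : ℕ} {S : Set ℝ} [DecidablePred (· ∈ S)] (hS : MeasurableSet S)
    (k : ℕ) :
    MeasurableSet {x : Fin n → ℝ | (Finset.univ.filter fun i => x i ∈ S).card = k} := by
  have h : Measurable fun x : Fin n → ℝ => (Finset.univ.filter fun i => x i ∈ S).card := by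
    simp_rw [Finset.card_filter]
    refine Finset.measurable_fun_sum _ fun i _ => ?_
    exact Measurable.ite (measurable_pi_apply i hS) measurable_const measurable_const
  exact h (measurableSet_singleton k)

theorem pi_real_card_lt {n : ℕ} (F : Measure ℝ) [IsProbabilityMeasure F] {S : Set ℝ}
    [DecidablePred (· ∈ S)] (hS : MeasurableSet S) (k : ℕ) :
    (Measure.pi fun _ : Fin n => F).real
        {x | (Finset.univ.filter fun i => x i ∈ S).card < k} = binLower n k (F.real S) := by
  have hset : {x : Fin n → ℝ | (Finset.univ.filter fun i => x i ∈ S).card < k} =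
      ⋃ j ∈ Finset.range k, {x | (Finset.univ.filter fun i => x i ∈ S).card = j} := by
    ext x
    simp
  rw [hset, measureReal_biUnion_finset]
  · exact Finset.sum_congr rfl fun j _ => pi_real_card_eq F hS j
  · intro i _ j _ hij
    exact Set.disjoint_left.2 fun x hx hy => hij (hx.symm.trans hy)
  · exact fun j _ => measurableSet_card_eq hS j

/-- If an independent sample falls into `S` with probability at least `1 / 2` at each draw, the
number of its points in `S` undercuts `m` no more often than a fair binomial variable does. -/
theorem measureReal_card_lt_le {Ω : Type*} [MeasurableSpace Ω] (μ : Measure Ω)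
    [IsProbabilityMeasure μ] (F : Measure ℝ) [IsProbabilityMeasure F] {n : ℕ} {X : Fin n → Ω → ℝ}
    (hindep : iIndepFun X μ) (hlaw : ∀ i, HasLaw (X i) F μ) {S : Set ℝ} [DecidablePred (· ∈ S)]
    (hS : MeasurableSet S) (hhalf : 1 / 2 ≤ F.real S) (m : ℤ) :
    μ.real {ω | ((Finset.univ.filter fun i => X i ω ∈ S).card : ℤ) < m} ≤ 1 - binTail n m := by
  have hX : ∀ i, AEMeasurable (X i) μ := fun i => (hlaw i).aemeasurable
  have hmap : μ.map (fun ω i => X i ω) = Measure.pi fun _ => F := by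
    rw [(iIndepFun_iff_map_fun_eq_pi_map hX).1 hindep]
    simp_rw [fun i => (hlaw i).map_eq]
  have hset : {ω | ((Finset.univ.filter fun i => X i ω ∈ S).card : ℤ) < m} =
      (fun ω i => X i ω) ⁻¹'
        {x : Fin n → ℝ | (Finset.univ.filter fun i => x i ∈ S).card < m.toNat} := by
    ext ω
    simp [Int.lt_toNat]
  have hmeas : MeasurableSet
      {x : Fin n → ℝ | (Finset.univ.filter fun i => x i ∈ S).card < m.toNat} := by
    have : {x : Fin n → ℝ | (Finset.univ.filter fun i => x i ∈ S).card < m.toNat} =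
      ⋃ j ∈ Finset.range m.toNat, {x | (Finset.univ.filter fun i => x i ∈ S).card = j} := by
      ext x
      simp
    rw [this]
    exact Finset.measurableSet_biUnion _ fun j _ => measurableSet_card_eq hS j
  rw [hset, measureReal_def, ← Measure.map_apply_of_aemeasurable (aemeasurable_pi_lambda _ hX) hmeas,
    hmap, ← measureReal_def, pi_real_card_lt F hS, binTail_eq, sub_sub_cancel]
  exact binLower_antitoneOn n _ ⟨by norm_num, by norm_num⟩ ⟨measureReal_nonneg, measureReal_le_one⟩
    hhalf

/-! ### Range of the constant -/

/-- Rounding `n / 2` down and up: `f = ⌊n / 2⌋` and `n - f = ⌈n / 2⌉`. -/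
theorem exists_floor_ceil_half (n : ℕ) : ∃ f : ℕ, ⌊(n : ℝ) / 2⌋ = f ∧
    ⌈(n : ℝ) / 2⌉ = (n : ℤ) - f ∧ 2 * f ≤ n ∧ n ≤ 2 * f + 1 := by
  have h1 : 2 * (n / 2) ≤ n := by omega
  have h2 : n ≤ 2 * (n / 2) + 1 := by omega
  have h1' : (2 : ℝ) * (n / 2 : ℕ) ≤ n := by exact_mod_cast h1
  have h2' : (n : ℝ) ≤ 2 * (n / 2 : ℕ) + 1 := by exact_mod_cast h2
  refine ⟨n / 2, ?_, ?_, h1, h2⟩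
  · rw [Int.floor_eq_iff, Int.cast_natCast]
    constructor <;> linarith
  · rw [Int.ceil_eq_iff, Int.cast_sub, Int.cast_natCast, Int.cast_natCast]
    constructor <;> linarith

theorem logb_le_iff {α : ℝ} (h0 : 0 < α) (n : ℕ) :
    Real.logb 2 (2 / α) ≤ n ↔ (1 / 2 : ℝ) ^ n ≤ α / 2 := by
  rw [Real.logb_le_iff_le_rpow (by norm_num) (by positivity), Real.rpow_natCast, div_pow, one_pow,
    div_le_iff₀ h0, div_le_div_iff₀ (by positivity) (by norm_num)]
  constructor <;> intro h <;> linarith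

theorem binLower_one_half (n : ℕ) : binLower n 1 (1 / 2) = (1 / 2 : ℝ) ^ n := by
  rw [binLower]
  norm_num

theorem binTail_one (n : ℕ) : binTail n 1 = 1 - (1 / 2 : ℝ) ^ n := by
  have h := binTail_natCast n 1
  rw [Nat.cast_one] at h
  rw [h, binLower_one_half]

theorem binLower_half_mono (n : ℕ) : Monotone fun k => binLower n k (1 / 2) := by
  intro i j hij
  exact Finset.sum_le_sum_of_subset_of_nonneg (Finset.range_mono hij)
    fun _ _ _ => by norm_num

theorem binLower_half_reflect {n k : ℕ} (hk : k ≤ n + 1) :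
    binLower n (n + 1 - k) (1 / 2) = 1 - binLower n k (1 / 2) := by
  have h := binLower_add_reflect hk (1 / 2)
  norm_num at h ⊢
  linarith

theorem binConst_nonneg {n : ℕ} {α : ℝ} (h0 : 0 < α) (h1 : α < 1) : 0 ≤ binConst n α := by
  obtain ⟨f, hf, -, hf1, hf2⟩ := exists_floor_ceil_half n
  have hc : 1 - α / 2 ≤ binTail n (⌊(n : ℝ) / 2⌋ - binConst n α) := (isLeast_binConst n h0 h1).1
  by_contra! hneg
  rw [hf] at hc
  have hle : binTail n (f - binConst n α) ≤ binTail n ((f + 1 : ℕ) : ℤ) :=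
    binTail_antitone n (by push_cast; omega)
  rw [binTail_natCast] at hle
  have hrefl := binLower_half_reflect (n := n) (k := f + 1) (by omega)
  have hmono := binLower_half_mono n (show n + 1 - (f + 1) ≤ f + 1 by omega)
  simp only at hmono
  linarith

theorem one_le_floor_sub_binConst {n : ℕ} {α : ℝ} (h0 : 0 < α) (h1 : α < 1)
    (hn : Real.logb 2 (2 / α) ≤ n) : 1 ≤ ⌊(n : ℝ) / 2⌋ - binConst n α := by
  have hmem : ⌊(n : ℝ) / 2⌋ - 1 ∈ {x : ℤ | 1 - α / 2 ≤ binTail n (⌊(n : ℝ) / 2⌋ - x)} := by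
    have := (logb_le_iff h0 n).1 hn
    change 1 - α / 2 ≤ binTail n (⌊(n : ℝ) / 2⌋ - (⌊(n : ℝ) / 2⌋ - 1))
    rw [sub_sub_cancel, binTail_one]
    linarith
  have := (isLeast_binConst n h0 h1).2 hmem
  omega

theorem binConst_eq_floor {n : ℕ} {α : ℝ} (h0 : 0 < α) (h1 : α < 1)
    (hn : (n : ℝ) < Real.logb 2 (2 / α)) : binConst n α = ⌊(n : ℝ) / 2⌋ := by
  have hpow : α / 2 < (1 / 2 : ℝ) ^ n := by
    by_contra! h
    exact absurd ((logb_le_iff h0 n).2 h) (not_le.2 hn)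
  have hc : 1 - α / 2 ≤ binTail n (⌊(n : ℝ) / 2⌋ - binConst n α) := (isLeast_binConst n h0 h1).1
  refine le_antisymm ((isLeast_binConst n h0 h1).2 ?_) ?_
  · change 1 - α / 2 ≤ binTail n (⌊(n : ℝ) / 2⌋ - ⌊(n : ℝ) / 2⌋)
    rw [sub_self, binTail_eq]
    simp only [Int.toNat_zero, binLower, Finset.range_zero, Finset.sum_empty]
    linarith
  · by_contra! hlt
    have := binTail_antitone n (show 1 ≤ ⌊(n : ℝ) / 2⌋ - binConst n α by omega)
    rw [binTail_one] at this
    linarith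

/-! ### Order statistics and the confidence interval -/

theorem card_filter_comp_sort {n : ℕ} (x : Fin n → ℝ) (P : ℝ → Prop) [DecidablePred P] :
    (Finset.univ.filter fun i => P (x (Tuple.sort x i))).card =
      (Finset.univ.filter fun i => P (x i)).card :=
  Finset.card_equiv (Tuple.sort x) (by simp)

theorem le_card_le_iff {n : ℕ} (x : Fin n → ℝ) {a : ℤ} (ha : 1 ≤ a) (han : a ≤ n) (θ : ℝ) :
    a ≤ ((Finset.univ.filter fun i => x i ≤ θ).card : ℤ) ↔ orderStat x a ≤ θ := by
  have h := Tuple.lt_card_le_iff_apply_le_of_monotone (j := ⟨(a - 1).toNat, by omega⟩) (a := θ)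
    (Tuple.monotone_sort x)
  simp only [Function.comp_apply] at h
  rw [card_filter_comp_sort x (· ≤ θ)] at h
  rw [orderStat, dif_pos ⟨ha, han⟩, ← h]
  omega

theorem le_card_ge_iff {n : ℕ} (x : Fin n → ℝ) {a : ℤ} (ha : 1 ≤ a) (han : a ≤ n) (θ : ℝ) :
    a ≤ ((Finset.univ.filter fun i => θ ≤ x i).card : ℤ) ↔ θ ≤ orderStat x (n + 1 - a) := by
  have h := Tuple.lt_card_lt_iff_apply_lt_of_monotone (j := ⟨(n + 1 - a - 1).toNat, by omega⟩)
    (a := θ) (Tuple.monotone_sort x)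
  simp only [Function.comp_apply] at h
  rw [card_filter_comp_sort x (· < θ)] at h
  have hsum := Finset.card_filter_add_card_filter_not (s := (Finset.univ : Finset (Fin n)))
    (fun i => x i < θ)
  simp only [not_lt, Finset.card_univ, Fintype.card_fin] at hsum
  rw [orderStat, dif_pos ⟨by omega, by omega⟩]
  refine Iff.trans ?_ ((not_congr h).trans not_lt)
  omega

theorem confInt_eq_Icc {n : ℕ} {α : ℝ} (x : Fin n → ℝ)
    (h1 : 1 ≤ ⌊(n : ℝ) / 2⌋ - binConst n α) (hn : ⌊(n : ℝ) / 2⌋ - binConst n α ≤ n) :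
    confInt n α x = Set.Icc (orderStat x (⌊(n : ℝ) / 2⌋ - binConst n α))
      (orderStat x (n + 1 - (⌊(n : ℝ) / 2⌋ - binConst n α))) := by
  ext θ
  exact and_congr (le_card_le_iff x h1 hn θ) (le_card_ge_iff x h1 hn θ)

theorem confInt_eq_univ {n : ℕ} {α : ℝ} (h : binConst n α = ⌊(n : ℝ) / 2⌋) (x : Fin n → ℝ) :
    confInt n α x = Set.univ := by
  ext θ
  simp [confInt, lowerSet, upperSet, h]

/-! ### Coverage -/

theorem one_sub_le_measureReal_mem_confInt {Ω : Type*} [MeasurableSpace Ω] (μ : Measure Ω)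
    [IsProbabilityMeasure μ] (F : Measure ℝ) [IsProbabilityMeasure F] {θ₀ : ℝ}
    (hmed_le : 1 / 2 ≤ F.real (Set.Iic θ₀)) (hmed_ge : 1 / 2 ≤ F.real (Set.Ici θ₀))
    {n : ℕ} {X : Fin n → Ω → ℝ} (hindep : iIndepFun X μ) (hlaw : ∀ i, HasLaw (X i) F μ)
    {α : ℝ} (h0 : 0 < α) (h1 : α < 1) :
    1 - α ≤ μ.real {ω | θ₀ ∈ confInt n α (fun i => X i ω)} := by
  have hc : 1 - α / 2 ≤ binTail n (⌊(n : ℝ) / 2⌋ - binConst n α) := (isLeast_binConst n h0 h1).1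
  have hl := measureReal_card_lt_le μ F hindep hlaw measurableSet_Iic hmed_le
    (⌊(n : ℝ) / 2⌋ - binConst n α)
  have hu := measureReal_card_lt_le μ F hindep hlaw measurableSet_Ici hmed_ge
    (⌊(n : ℝ) / 2⌋ - binConst n α)
  simp only [Set.mem_Iic] at hl
  simp only [Set.mem_Ici] at hu
  -- Subadditivity over the cover by the event and its two failure modes needs no measurability.
  have hcov : (Set.univ : Set Ω) ⊆ {ω | θ₀ ∈ confInt n α (fun i => X i ω)} ∪
      ({ω | ((Finset.univ.filter fun i => X i ω ≤ θ₀).card : ℤ) < ⌊(n : ℝ) / 2⌋ - binConst n α} ∪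
       {ω | ((Finset.univ.filter fun i => θ₀ ≤ X i ω).card : ℤ) <
        ⌊(n : ℝ) / 2⌋ - binConst n α}) := by
    intro ω _
    by_contra hω
    simp only [Set.mem_union, not_or] at hω
    have hle : ⌊(n : ℝ) / 2⌋ - binConst n α ≤
        ((Finset.univ.filter fun i => X i ω ≤ θ₀).card : ℤ) := not_lt.1 hω.2.1
    have hge : ⌊(n : ℝ) / 2⌋ - binConst n α ≤
        ((Finset.univ.filter fun i => θ₀ ≤ X i ω).card : ℤ) := not_lt.1 hω.2.2
    exact hω.1 ⟨hle, hge⟩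
  have h := (measureReal_mono (μ := μ) hcov).trans (measureReal_union_le _ _)
  have h' := h.trans (add_le_add_right (measureReal_union_le _ _) _)
  rw [probReal_univ] at h'
  linarith

/-! ### Comparison of the constant with the normal quantile -/

theorem normalUpperQuantile_nonneg {β : ℝ} (h0 : 0 < β) (h1 : β < 1 / 2) :
    0 ≤ normalUpperQuantile β := by
  have hz : 1 - β ≤ cdf (gaussianReal 0 1) (normalUpperQuantile β) :=
    (isLeast_normalUpperQuantile h0 (by linarith)).1
  by_contra! hneg
  have h := monotone_cdf (gaussianReal 0 1) hneg.le
  have h2 := cdf_gaussian_neg_eq 0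
  rw [neg_zero] at h2
  linarith

theorem normalUpperQuantile_le_of_cdf_neg_le {β t : ℝ} (h0 : 0 < β) (h1 : β < 1)
    (h : cdf (gaussianReal 0 1) (-t) ≤ β) : normalUpperQuantile β ≤ t := by
  refine (isLeast_normalUpperQuantile h0 h1).2 ?_
  rw [cdf_gaussian_neg_eq] at h
  change 1 - β ≤ cdf (gaussianReal 0 1) t
  linarith

/-- If `c - 1` exceeded `√n z / 2`, then at `m = ⌊n / 2⌋ - (c - 1)` the Zubkov–Serov inequality and
Pinsker's inequality would give `P(Y ≥ m) ≥ Φ(z)`, against the minimality of `c`. -/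
theorem binConst_le {n : ℕ} {α : ℝ} (h0 : 0 < α) (h1 : α < 1) :
    (binConst n α : ℝ) ≤ Real.sqrt n * normalUpperQuantile (α / 2) / 2 + 1 := by
  set z := normalUpperQuantile (α / 2) with hzdef
  have hz0 : 0 ≤ z := normalUpperQuantile_nonneg (by linarith) (by linarith)
  have hz : 1 - α / 2 ≤ cdf (gaussianReal 0 1) z :=
    (isLeast_normalUpperQuantile (by linarith) (by linarith)).1
  obtain ⟨f, hf, -, hf1, hf2⟩ := exists_floor_ceil_half n
  by_contra! hcon
  have hj : Real.sqrt n * z / 2 < ((binConst n α - 1 : ℤ) : ℝ) := by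
    push_cast
    linarith
  have hjpos : 0 < binConst n α - 1 := by
    have : (0 : ℝ) < ((binConst n α - 1 : ℤ) : ℝ) := lt_of_le_of_lt (by positivity) hj
    exact_mod_cast this
  have htail : binTail n (f - (binConst n α - 1)) < 1 - α / 2 := by
    by_contra! h
    rw [← hf] at h
    have := (isLeast_binConst n h0 h1).2 h
    omega
  rcases le_or_gt ((f : ℤ) - (binConst n α - 1)) 0 with hm | hm
  · rw [binTail_eq, Int.toNat_of_nonpos hm] at htail
    simp only [binLower, Finset.range_zero, Finset.sum_empty] at htail
    linarith
  obtain ⟨m, hm'⟩ := Int.eq_ofNat_of_zero_le hm.le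
  rw [hm', binTail_natCast] at htail
  have hm0 : 0 < m := by omega
  have hmn : 2 * m < n := by omega
  have hn' : (0 : ℝ) < n := by
    have : 0 < n := by omega
    exact_mod_cast this
  have hmn' : (2 : ℝ) * m < n := by exact_mod_cast hmn
  have hx : (m : ℝ) / n < 1 / 2 := by
    rw [div_lt_div_iff₀ hn' (by norm_num)]
    linarith
  have hx0 : (0 : ℝ) < m / n := by positivity
  have hZS := cdf_signedRoot_le_one_sub_binLower hm0 (show m < n by omega)
    (p := 1 / 2) (by norm_num) (by norm_num) hx.ne'
  rw [signedRoot, if_neg (by linarith)] at hZS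
  refine absurd (hz.trans (monotone_cdf _ ?_)) (not_le.2 (hZS.trans_lt htail))
  have hpin := two_mul_sq_le_relEnt (x := 1 - m / n) (by linarith) (by linarith)
  rw [← relEnt_compl, sub_sub_cancel, show (1 : ℝ) - 1 / 2 = 1 / 2 by norm_num] at hpin
  have hz1 : Real.sqrt n * z ≤ n - 2 * m := by
    have e : ((binConst n α - 1 : ℤ) : ℝ) = f - m := by
      have : binConst n α - 1 = (f : ℤ) - m := by omega
      rw [this]
      push_cast
      ring
    have e2 : (2 : ℝ) * f ≤ n := by exact_mod_cast hf1
    linarith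
  refine Real.le_sqrt_of_sq_le ?_
  have hsq : (Real.sqrt n * z) ^ 2 ≤ (n - 2 * m) ^ 2 := pow_le_pow_left₀ (by positivity) hz1 2
  have hn2 : n * z ^ 2 ≤ n * (2 * n * relEnt (m / n) (1 / 2)) := by
    calc (n : ℝ) * z ^ 2 = (Real.sqrt n * z) ^ 2 := by rw [mul_pow, Real.sq_sqrt hn'.le]
      _ ≤ ((n : ℝ) - 2 * m) ^ 2 := hsq
      _ = n * (2 * n * (2 * (1 - (m : ℝ) / n - 1 / 2) ^ 2)) := by
        field_simp
        ring
      _ ≤ _ := by gcongr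
  exact le_of_mul_le_mul_left hn2 hn'

/-- The quantile is bounded by `√(n H(u))`, where `u = (2k - n) / n` and `H` is the entropy
function of `entropy_le`: from the Zubkov–Serov inequality for `k < n`, and from the Gaussian
Chernoff bound for `k = n`. -/
theorem normalUpperQuantile_le_of_tail_le {n k : ℕ} {β : ℝ} (h0 : 0 < β) (h1 : β < 1)
    (hkn : k ≤ n) (hk : n < 2 * k) (htail : 1 - binLower n k (1 / 2) ≤ β) :
    normalUpperQuantile β ≤
      Real.sqrt n * ((2 * k - n) / n + ((2 * k - n) / n) ^ 3 / 5) := by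
  have hn' : (0 : ℝ) < n := by
    have : 0 < n := by omega
    exact_mod_cast this
  have hk' : (n : ℝ) < 2 * k := by exact_mod_cast hk
  have hkn' : (k : ℝ) ≤ n := by exact_mod_cast hkn
  set u : ℝ := (2 * k - n) / n with hu
  have hu0 : 0 ≤ u := div_nonneg (by linarith) hn'.le
  have hu1 : u ≤ 1 := by
    rw [hu, div_le_one hn']
    linarith
  have hx : (k : ℝ) / n = (1 + u) / 2 := by
    rw [hu]
    field_simp
    ring
  have hent := entropy_le hu0 hu1
  refine (normalUpperQuantile_le_of_cdf_neg_le (t := Real.sqrt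
    (n * ((1 + u) * Real.log (1 + u) + (1 - u) * Real.log (1 - u)))) h0 h1 ?_).trans ?_
  · rcases hkn.lt_or_eq with hlt | heq
    · have hx2 : (1 : ℝ) / 2 < k / n := by
        rw [div_lt_div_iff₀ (by norm_num) hn']
        linarith
      have hZS := cdf_signedRoot_le_one_sub_binLower (show 0 < k by omega) hlt
        (p := 1 / 2) (by norm_num) (by norm_num) hx2.ne
      rw [signedRoot, if_pos hx2, mul_comm 2 (n : ℝ), mul_assoc, hx, relEnt_half] at hZS
      exact hZS.trans htail
    · have hu' : u = 1 := by
        rw [hu, heq]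
        field_simp
        ring
      refine (cdf_gaussian_neg_le_exp (Real.sqrt_nonneg _)).trans (le_trans (le_of_eq ?_) htail)
      have hlog2 := Real.log_pos (show (1 : ℝ) < 2 by norm_num)
      have hent1 : (1 + 1) * Real.log (1 + 1) + (1 - 1) * Real.log (1 - 1) = 2 * Real.log 2 := by
        norm_num
      have hrefl := binLower_half_reflect (n := n) (k := 1) (by omega)
      rw [Nat.add_sub_cancel] at hrefl
      rw [hu', heq, hrefl, sub_sub_cancel, binLower_one_half, hent1, Real.sq_sqrt (by positivity),
        show -(n * (2 * Real.log 2) / 2) = n * Real.log (1 / 2) by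
          rw [one_div, Real.log_inv]
          ring,
        ← Real.log_pow, Real.exp_log (by positivity)]
  · rw [Real.sqrt_le_left (by positivity), mul_pow, Real.sq_sqrt hn'.le]
    gcongr

/-- For `s > u` the subtracted `s ^ 3 / 5` outweighs `u ^ 3 / 5`; for `s ≤ u` the bound is trivial. -/
theorem sub_cube_le {s u : ℝ} (hs : 0 ≤ s) (h : s ≤ u + u ^ 3 / 5) : s - s ^ 3 / 5 ≤ u := by
  rcases le_total s u with hle | hle
  · have : 0 ≤ s ^ 3 := by positivity
    linarith
  · have : u ^ 3 ≤ s ^ 3 := Odd.strictMono_pow (by decide) |>.monotone hle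
    linarith

/-- The defining property of `c` says `P(Y ≥ k) ≤ α / 2` for `k = ⌈n / 2⌉ + c + 1`, which bounds the
quantile by `normalUpperQuantile_le_of_tail_le`; `sub_cube_le` then solves for `c`. -/
theorem le_binConst {n : ℕ} {α : ℝ} (h0 : 0 < α) (h1 : α < 1)
    (hn : Real.logb 2 (2 / α) ≤ n) :
    Real.sqrt n * normalUpperQuantile (α / 2) / 2 -
      1 / (2 * Real.sqrt n) * (normalUpperQuantile (α / 2) ^ 3 / 5) - 3 / 2 ≤ binConst n α := by
  set z := normalUpperQuantile (α / 2) with hzdef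
  have hz0 : 0 ≤ z := normalUpperQuantile_nonneg (by linarith) (by linarith)
  obtain ⟨f, hf, -, hf1, hf2⟩ := exists_floor_ceil_half n
  have hc : 1 - α / 2 ≤ binTail n (⌊(n : ℝ) / 2⌋ - binConst n α) := (isLeast_binConst n h0 h1).1
  have hone := one_le_floor_sub_binConst h0 h1 hn
  have hcn := binConst_nonneg (n := n) h0 h1
  rw [hf] at hc hone
  obtain ⟨m, hm⟩ := Int.eq_ofNat_of_zero_le (zero_le_one.trans hone)
  rw [hm, binTail_natCast] at hc
  have hrefl := binLower_half_reflect (n := n) (k := m) (by omega)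
  have hn' : (0 : ℝ) < n := by
    have : 0 < n := by omega
    exact_mod_cast this
  have hq := normalUpperQuantile_le_of_tail_le (n := n) (k := n + 1 - m) (β := α / 2)
    (by linarith) (by linarith) (by omega) (by omega) (by linarith)
  rw [← hzdef] at hq
  set u : ℝ := (2 * (n + 1 - m : ℕ) - n) / n with hu
  have hs : 0 < Real.sqrt n := Real.sqrt_pos.2 hn'
  have hss : Real.sqrt n ^ 2 = n := Real.sq_sqrt hn'.le
  have hcube := sub_cube_le (s := z / Real.sqrt n) (u := u) (by positivity) (by
    rw [div_le_iff₀ hs]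
    linarith)
  have hnu : n * u = n + 2 - 2 * m := by
    rw [hu, Nat.cast_sub (by omega)]
    push_cast
    field_simp
    ring
  have hcm : (binConst n α : ℝ) = f - m := by
    have : binConst n α = (f : ℤ) - m := by omega
    rw [this]
    push_cast
    ring
  have hf2' : (n : ℝ) ≤ 2 * f + 1 := by exact_mod_cast hf2
  have hmul := mul_le_mul_of_nonneg_left hcube hn'.le
  rw [hnu] at hmul
  have hid : ∀ r : ℝ, 0 < r → r ^ 2 * (z / r - (z / r) ^ 3 / 5) =
      2 * (r * z / 2 - 1 / (2 * r) * (z ^ 3 / 5)) := fun r hr => by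
    field_simp
  have hid := hid (Real.sqrt n) hs
  rw [hss] at hid
  rw [hid] at hmul
  linarith

end MedianCI

theorem theorem1 {Ω : Type*} [MeasurableSpace Ω] (μ : Measure Ω) [IsProbabilityMeasure μ]
    (F : Measure ℝ) [IsProbabilityMeasure F] (θ₀ : ℝ)
    (hmed_le : 1 / 2 ≤ F.real (Set.Iic θ₀)) (hmed_ge : 1 / 2 ≤ F.real (Set.Ici θ₀))
    (n : ℕ) (hn : 1 ≤ n) (X : Fin n → Ω → ℝ)
    (hindep : iIndepFun X μ) (hlaw : ∀ i, HasLaw (X i) F μ) :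
    -- coverage
    (∀ α : ℝ, 0 < α → α < 1 →
      1 - α ≤ μ.real {ω | θ₀ ∈ MedianCI.confInt n α (fun i => X i ω)}) ∧
    -- form of the confidence interval
    (∀ α : ℝ, 0 < α → α < 1 →
      (Real.logb 2 (2 / α) ≤ n →
        ⌊(n : ℝ) / 2⌋ - MedianCI.binConst n α ∈ Set.Icc (1 : ℤ) n ∧
        ⌈(n : ℝ) / 2⌉ + MedianCI.binConst n α + 1 ∈ Set.Icc (1 : ℤ) n ∧
        ∀ ω, MedianCI.confInt n α (fun i => X i ω) =
          Set.Icc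
            (MedianCI.orderStat (fun i => X i ω) (⌊(n : ℝ) / 2⌋ - MedianCI.binConst n α))
            (MedianCI.orderStat (fun i => X i ω) (⌈(n : ℝ) / 2⌉ + MedianCI.binConst n α + 1))) ∧
      ((n : ℝ) < Real.logb 2 (2 / α) →
        ∀ ω, MedianCI.confInt n α (fun i => X i ω) = Set.univ)) ∧
    -- bounds on the constant
    (∀ α : ℝ, 0 < α → α < 1 →
      (Real.logb 2 (2 / α) ≤ n →
        (MedianCI.binConst n α : ℝ) - Real.sqrt n * MedianCI.normalUpperQuantile (α / 2) / 2 ∈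
          Set.Icc
            (-(1 / (2 * Real.sqrt n)) *
                max (MedianCI.normalUpperQuantile (α / 2) ^ 3 / 5)
                  (Real.sqrt (1 + (2 * Real.log 2 - 1) / (n : ℝ) ^ 2)) - 1.5)
            1) ∧
      ((n : ℝ) < Real.logb 2 (2 / α) →
        (MedianCI.binConst n α : ℝ) - Real.sqrt n * MedianCI.normalUpperQuantile (α / 2) / 2 =
          (⌊(n : ℝ) / 2⌋ : ℝ) - Real.sqrt n * MedianCI.normalUpperQuantile (α / 2) / 2)) := by
  refine ⟨fun α h0 h1 => MedianCI.one_sub_le_measureReal_mem_confInt μ F hmed_le hmed_ge hindep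
    hlaw h0 h1, fun α h0 h1 => ⟨fun hα => ?_, fun hα ω =>
      MedianCI.confInt_eq_univ (MedianCI.binConst_eq_floor h0 h1 hα) _⟩,
    fun α h0 h1 => ⟨fun hα => ⟨?_, ?_⟩, fun hα => by
      rw [MedianCI.binConst_eq_floor h0 h1 hα]⟩⟩
  · obtain ⟨f, hf, hf', hf1, hf2⟩ := MedianCI.exists_floor_ceil_half n
    have hone := MedianCI.one_le_floor_sub_binConst h0 h1 hα
    have hc := MedianCI.binConst_nonneg (n := n) h0 h1
    have hle : ⌊(n : ℝ) / 2⌋ - MedianCI.binConst n α ≤ n := by omega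
    have hidx : ⌈(n : ℝ) / 2⌉ + MedianCI.binConst n α + 1 =
        n + 1 - (⌊(n : ℝ) / 2⌋ - MedianCI.binConst n α) := by omega
    refine ⟨⟨hone, hle⟩, ?_, fun ω => ?_⟩
    · rw [hidx]
      constructor <;> omega
    · rw [hidx]
      exact MedianCI.confInt_eq_Icc _ hone hle
  · have hle := MedianCI.le_binConst h0 h1 hα
    have hmax := mul_le_mul_of_nonneg_left
      (le_max_left (MedianCI.normalUpperQuantile (α / 2) ^ 3 / 5)
        (Real.sqrt (1 + (2 * Real.log 2 - 1) / (n : ℝ) ^ 2)))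
      (show 0 ≤ 1 / (2 * Real.sqrt n) by positivity)
    linarith
  · have hle := MedianCI.binConst_le (n := n) h0 h1
    linarith
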